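/- All groups are profinite, subgroups are closed, homomorphisms are continuous, and an epimorphism is a surjective homomorphism. For an epimorphism $\pi\colon H\twoheadrightarrow G$ define closed normal subgroups $M_0(\pi)\ge M_1(\pi)\ge\cdots$ of $H$ by $M_0(\pi)=\ker\pi$ and, for $k\ge1$, let $M_k(\pi)$ be the intersection of all maximal members of the set of closed normal subgroups of $H$ strictly contained in $M_{k-1}(\pi)$ (with $M_k(\pi)=1$ if $M_{k-1}(\pi)=1$). Put $G_0=G=H/M_0(\pi)$ and $G_k=H/M_k(\pi)$ for $k\ge 1$. Let $\rho_k\colon H\twoheadrightarrow G_k$ be the quotient maps (so $\rho_0=\pi$), and for $k\ge1$ let $\pi_k\colon G_k\twoheadrightarrow G_{k-1}$ be the induced maps. The sequence $\cdots\xrightarrow{\pi_2}G_1\xrightarrow{\pi_1}G_0=G$ is the fundament series of $\pi$. A commutative square of epimorphisms $$\begin{array}{ccc} A&\xrightarrow{\ \tau\ }&A'\\ {\scriptstyle\alpha}\downarrow&&\downarrow{\scriptstyle\alpha'}\\ B&\xrightarrow{\ \tau_0\ }&B'\end{array}$$ is denoted $(\alpha,\tau_0,\tau,\alpha')$; it is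 called semi-cartesian if $\tau(\ker\alpha)=\ker\alpha'$. Theorem. Let $(\pi,\theta_0,\theta,\pi')$ be a commutative square of epimorphisms, where $\pi\colon H\twoheadrightarrow G$, $\theta_0\colon G\twoheadrightarrow G'$, $\theta\colon H\twoheadrightarrow H'$ and $\pi'\colon H'\twoheadrightarrow G'$. Let $G_k,\rho_k,\pi_k$ and $G'_k,\rho'_k,\pi'_k$ be the groups and maps of the fundament series of $\pi$ and of $\pi'$, respectively. (a) There are epimorphisms $\theta_k\colon G_k\twoheadrightarrow G'_k$ for $k\ge 1$ such that, together with the given $\theta_0$, for all $k\ge0$, $$\pi_{k+1}\circ\rho_{k+1}=\rho_k,\quad \pi'_{k+1}\circ\rho'_{k+1}=\rho'_k,\quad \rho'_k\circ\theta=\theta_k\circ\rho_k,\quad \pi'_{k+1}\circ\theta_{k+1}=\theta_k\circ\pi_{k+1}.$$ Moreover, for every family $(\theta_k)_{k\ge0}$ as in (a), extending the given $\theta_0$: (b) If the square $(\pi,\theta_0,\theta,\pi')$ is semi-cartesian, then so are the squares $(\rho_k,\theta_k,\theta,\rho'_k)$ and $(\pi_{k+1},\theta_k,\theta_{k+1},\pi'_{k+1})$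 for every $k\ge0$. (c) If $\theta_0$ and $\theta$ are isomorphisms (of profinite groups), then so is $\theta_k$ for every $k\ge0$. -/

import Mathlib

open CategoryTheory

universe u

namespace Fundament

section Subgroups

variable {H : Type u} [Group H] [TopologicalSpace H]

/-- `IsMaximalNormalIn M N`: the subgroup `N` is a maximal one among all closed normal subgroups
of `H` that are strictly contained in `M`. -/
def IsMaximalNormalIn (M N : Subgroup H) : Prop :=
  Maximal (fun L : Subgroup H => L.Normal ∧ IsClosed (L : Set H) ∧ L < M) N

/-- The intersection of all closed normal subgroups of `H` that are maximal among those strictly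
contained in `M`; the intersection is taken inside `M`, so it is `M` if there are none (for `M`
closed and normal in a profinite group `H`, this occurs only if `M` is trivial). -/
def maximalNormalInf (M : Subgroup H) : Subgroup H :=
  M ⊓ sInf {N : Subgroup H | IsMaximalNormalIn M N}

theorem normal_maximalNormalInf (M : Subgroup H) (hM : M.Normal) :
    (maximalNormalInf M).Normal := by
  refine ⟨fun x hx g => ?_⟩
  obtain ⟨h1, h2⟩ := Subgroup.mem_inf.1 hx
  refine Subgroup.mem_inf.2 ⟨hM.conj_mem x h1 g, ?_⟩
  rw [Subgroup.mem_sInf] at h2 ⊢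
  exact fun N hN => (Set.mem_ofPred.1 hN : IsMaximalNormalIn M N).prop.1.conj_mem x (h2 N hN) g

theorem isClosed_maximalNormalInf (M : Subgroup H) (hM : IsClosed (M : Set H)) :
    IsClosed (maximalNormalInf M : Set H) := by
  rw [maximalNormalInf, Subgroup.coe_inf, Subgroup.coe_sInf]
  exact hM.inter (isClosed_biInter fun N hN => (Set.mem_ofPred.1 hN : IsMaximalNormalIn M N).prop.2.1)

end Subgroups

/-- The quotient of a profinite group by a closed normal subgroup is totally disconnected. -/
theorem totallyDisconnectedSpace_quotient (H : ProfiniteGrp.{u}) (N : Subgroup H)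
    (hN : IsClosed (N : Set H)) : TotallyDisconnectedSpace (H ⧸ N) := by
  refine ⟨fun t _ ht x hx y hy => ?_⟩
  induction x using QuotientGroup.induction_on with | H x => ?_
  induction y using QuotientGroup.induction_on with | H y => ?_
  rw [QuotientGroup.eq]
  have key := ProfiniteGrp.closedSubgroup_eq_sInf_open (G := H) ⟨N, hN⟩
  change N = _ at key
  rw [key, Subgroup.mem_sInf]
  rintro K ⟨hK, hNK⟩
  have hNK' : N ≤ K := hNK
  have : DiscreteTopology (H ⧸ K) := QuotientGroup.discreteTopology hK
  have hc : Continuous (Subgroup.quotientMapOfLE hNK') :=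
    continuous_quot_lift _ QuotientGroup.continuous_mk
  have hs := (ht.image _ hc.continuousOn).subsingleton
  exact QuotientGroup.eq.1 (hs (Set.mem_image_of_mem _ hx) (Set.mem_image_of_mem _ hy))

section Series

variable {H G : ProfiniteGrp.{u}}

/-- The fundament kernel series of `π : H ⟶ G`: it starts with the kernel of `π`, and each
further term is the intersection of the closed normal subgroups of `H` that are maximal among
those strictly contained in the previous term. -/
def kernelSeries (π : H ⟶ G) : ℕ → Subgroup H
  | 0 => π.hom.toMonoidHom.ker
  | k + 1 => maximalNormalInf (kernelSeries π k)

instance normal_kernelSeries (π : H ⟶ G) (k : ℕ) : (kernelSeries π k).Normal := by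
  induction k with
  | zero => exact MonoidHom.normal_ker _
  | succ k ih => exact normal_maximalNormalInf _ ih

theorem isClosed_kernelSeries (π : H ⟶ G) (k : ℕ) :
    IsClosed (kernelSeries π k : Set H) := by
  induction k with
  | zero => exact isClosed_singleton.preimage π.hom.continuous_toFun
  | succ k ih => exact isClosed_maximalNormalInf _ ih

instance totallyDisconnectedSpace_quotient_kernelSeries (π : H ⟶ G) (k : ℕ) :
    TotallyDisconnectedSpace (H ⧸ kernelSeries π k) :=
  totallyDisconnectedSpace_quotient H _ (isClosed_kernelSeries π k)

/-- The groups of the fundament series of `π : H ⟶ G`: the group `G` itself (identified by `π`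
with the quotient of `H` by the kernel of `π`), and then the quotients of `H` by the further
members of the fundament kernel series. -/
def term (π : H ⟶ G) : ℕ → ProfiniteGrp.{u}
  | 0 => G
  | k + 1 => ProfiniteGrp.of (H ⧸ kernelSeries π (k + 1))

/-- The canonical maps `ρ k` from `H` to the groups of the fundament series of `π`: the map `π`
for `k = 0`, and the quotient maps for `k > 0`. -/
def proj (π : H ⟶ G) : (k : ℕ) → (H ⟶ term π k)
  | 0 => π
  | k + 1 => ProfiniteGrp.ofHom (Y := H ⧸ kernelSeries π (k + 1))
      ⟨QuotientGroup.mk' (kernelSeries π (k + 1)), QuotientGroup.continuous_mk⟩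

/-- The maps of the fundament series of `π`, induced from the identity of `H`: here `series π k`,
from the term with index `k + 1` to the term with index `k`, is the `(k + 1)`-st fundament
of `π`. -/
def series (π : H ⟶ G) : (k : ℕ) → (term π (k + 1) ⟶ term π k)
  | 0 => ProfiniteGrp.ofHom (X := H ⧸ kernelSeries π 1)
      ⟨QuotientGroup.lift (kernelSeries π 1) π.hom.toMonoidHom
          (fun _ hx => (Subgroup.mem_inf.1 hx).1),
        continuous_quot_lift _ π.hom.continuous_toFun⟩
  | k + 1 => ProfiniteGrp.ofHom (X := H ⧸ kernelSeries π (k + 2))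
      (Y := H ⧸ kernelSeries π (k + 1))
      ⟨QuotientGroup.map (kernelSeries π (k + 2)) (kernelSeries π (k + 1)) (MonoidHom.id H)
          (fun _ hx => (Subgroup.mem_inf.1 hx).1),
        continuous_quot_lift _ QuotientGroup.continuous_mk⟩

end Series

section Squares

variable {H G H' G' : ProfiniteGrp.{u}}

/-- A commutative square of epimorphisms of profinite groups, with left side `π : H ⟶ G`, bottom
`θ₀ : G ⟶ G'`, top `θ : H ⟶ H'` and right side `π' : H' ⟶ G'`. -/
structure IsEpiSquare (π : H ⟶ G) (θ₀ : G ⟶ G') (θ : H ⟶ H') (π' : H' ⟶ G') : Prop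
    extends CommSq θ π π' θ₀ where
  surjective_left : Function.Surjective π
  surjective_bottom : Function.Surjective θ₀
  surjective_top : Function.Surjective θ
  surjective_right : Function.Surjective π'

/-- A commutative square of epimorphisms is semi-cartesian if `θ` maps the kernel of `π` onto the
kernel of `π'`. -/
structure IsSemiCartesian (π : H ⟶ G) (θ₀ : G ⟶ G') (θ : H ⟶ H') (π' : H' ⟶ G') : Prop
    extends IsEpiSquare π θ₀ θ π' where
  map_ker : π.hom.toMonoidHom.ker.map θ.hom.toMonoidHom = π'.hom.toMonoidHom.ker

/-- The maps `t k` between the terms of the fundament series of `π : H ⟶ G` and of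
`π' : H' ⟶ G'` start with `θ₀ : G ⟶ G'` and fit, together with `θ : H ⟶ H'`, into one commutative
diagram of epimorphisms. -/
structure IsSeriesDiagram (π : H ⟶ G) (θ₀ : G ⟶ G') (θ : H ⟶ H') (π' : H' ⟶ G')
    (t : (k : ℕ) → (term π k ⟶ term π' k)) : Prop where
  zero : t 0 = θ₀
  top_triangle : ∀ k, proj π (k + 1) ≫ series π k = proj π k
  bottom_triangle : ∀ k, proj π' (k + 1) ≫ series π' k = proj π' k
  proj_square : ∀ k, IsEpiSquare (proj π k) (t k) θ (proj π' k)
  series_square : ∀ k, IsEpiSquare (series π k) (t k) (t (k + 1)) (series π' k)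

end Squares

end Fundament

/-! ### Lower covers and relative complements in modular lattices. -/

section ModularLattice

variable {X : Type*} [Lattice X] [IsModularLattice X]

/-! Write `Φ(M)` for the intersection of `M` with its lower covers among closed normal subgroups.
Everything reduces to how `Φ` behaves under an epimorphism `f`. If `f(M) ≤ M'`, then `f(Φ(M)) ≤
Φ(M')`: the preimage of a lower cover of `M'` contains `M` or meets it in a lower cover, by
modularity (`ClosedNormal.coverInf_le_comap`). Induction on `k` yields the maps of (a). For (b) one
needs the equality `f(Φ(M)) = Φ(f(M))` (`ClosedNormal.map_coverInf`). It rests on a semisimplicity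
of `M/Φ(M)`: every closed normal subgroup between `Φ(M)` and `M` is an intersection of lower covers
of `M`. For finite meets this follows from relative complements in a modular lattice; compactness
gives the general case. In (c) the square is automatically semi-cartesian, so (b) identifies the
kernels. -/

theorem CovBy.inf_covBy_left_of_not_le {E N M : X} (h : N ⋖ M) (hE : E ≤ M) (hEN : ¬ E ≤ N) :
    E ⊓ N ⋖ E := by
  have : E ⊔ N = M := by
    rcases h.eq_or_eq (c := E ⊔ N) le_sup_right (sup_le hE h.le) with h1 | h1
    · exact absurd (h1 ▸ le_sup_left) hEN
    · exact h1
  -- The intervals `[E ⊓ N, E]` and `[N, E ⊔ N]` are isomorphic by modularity.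
  exact inf_covBy_of_covBy_sup_right (this ▸ h)

/-- In a modular lattice, every element below `M` has a complement in `M` relative to a finite
meet of lower covers of `M`. -/
theorem exists_relative_complement_of_covBy [OrderTop X] {M P : X} (hP : P ≤ M) (S : Finset X)
    (hS : ∀ N ∈ S, N ⋖ M) :
    ∃ E ≤ M, M ⊓ S.inf id ≤ E ∧ P ⊔ E = M ∧ P ⊓ E ≤ M ⊓ S.inf id := by
  classical
  induction S using Finset.induction_on with
  | empty => exact ⟨M, le_rfl, inf_le_left, sup_eq_right.2 hP, by simp⟩
  | insert N S _ ih =>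
    obtain ⟨E, hEM, hQE, hsup, hinf⟩ := ih fun K hK => hS K (Finset.mem_insert_of_mem hK)
    have hN := hS N (Finset.mem_insert_self N S)
    rw [Finset.inf_insert, id, inf_left_comm]
    -- If `P ⊓ E` is not below `N`, shrink `E` to `E ⊓ N`. This loses only one covering step, which
    -- `P ⊓ E` makes up, so the join with `P` is still `M`.
    by_cases hle : P ⊓ E ≤ N
    · exact ⟨E, hEM, inf_le_right.trans hQE, hsup, le_inf hle hinf⟩
    · have hEN : E ⊓ N ⋖ E := hN.inf_covBy_left_of_not_le hEM fun h => hle (inf_le_right.trans h)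
      refine ⟨E ⊓ N, inf_le_left.trans hEM, le_inf (inf_le_right.trans hQE) inf_le_left, ?_,
        le_inf (inf_le_right.trans inf_le_right) ((inf_le_inf_left P inf_le_left).trans hinf)⟩
      have hE : (P ⊓ E) ⊔ (E ⊓ N) = E := by
        rcases hEN.eq_or_eq (c := (P ⊓ E) ⊔ (E ⊓ N)) le_sup_right (sup_le inf_le_right inf_le_left)
          with h | h
        · exact absurd ((h ▸ le_sup_left : P ⊓ E ≤ E ⊓ N).trans inf_le_right) hle
        · exact h
      refine le_antisymm (sup_le hP (inf_le_left.trans hEM)) (hsup ▸ sup_le le_sup_left ?_)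
      exact hE.symm.le.trans (sup_le_sup_right inf_le_left _)

/-- In a modular lattice, an element between `M` and a finite meet of lower covers of `M` is
itself the meet of the lower covers of `M` above it. -/
theorem le_of_forall_covBy_le [OrderTop X] {M P Y : X} (hP : P ≤ M) (S : Finset X)
    (hS : ∀ N ∈ S, N ⋖ M) (hSP : M ⊓ S.inf id ≤ P) (hY : Y ≤ M)
    (h : ∀ T, P ≤ T → T ⋖ M → Y ≤ T) : Y ≤ P := by
  obtain ⟨E, hEM, -, hsup, hinf⟩ := exists_relative_complement_of_covBy hP S hS
  -- As `P ⊔ E = M`, modularity leaves only the part of `P ⊔ Y` inside the complement `E` to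
  -- control. If `E` is not below `N`, the lower cover `P ⊔ E ⊓ N` of `M` contains `P`, hence `Y`,
  -- and cuts `E` exactly in `E ⊓ N`.
  have key : (P ⊔ Y) ⊓ E ≤ M ⊓ S.inf id := by
    refine le_inf (inf_le_right.trans hEM) (Finset.le_inf fun N hN => ?_)
    by_cases hEN : E ≤ N
    · exact inf_le_right.trans hEN
    · have hPN : P ⊓ E ≤ E ⊓ N := le_inf inf_le_right
        (hinf.trans (inf_le_right.trans (Finset.inf_le (f := id) hN)))
      have hTE : E ⊓ (P ⊔ E ⊓ N) = E ⊓ N := by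
        rw [inf_comm, sup_comm, sup_inf_assoc_of_le P (inf_le_left : E ⊓ N ≤ E)]
        exact sup_eq_left.2 hPN
      have hT : P ⊔ E ⊓ N ⋖ M := by
        have hc : E ⊓ (P ⊔ E ⊓ N) ⋖ E := hTE.symm ▸ (hS N hN).inf_covBy_left_of_not_le hEM hEN
        have := covBy_sup_of_inf_covBy_left hc
        rwa [sup_left_comm, sup_eq_left.2 (inf_le_left : E ⊓ N ≤ E), hsup] at this
      calc (P ⊔ Y) ⊓ E ≤ (P ⊔ E ⊓ N) ⊓ E := inf_le_inf_right E (sup_le le_sup_left (h _ le_sup_left hT))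
        _ = E ⊓ N := by rw [inf_comm, hTE]
        _ ≤ N := inf_le_right
  calc Y ≤ (P ⊔ Y) ⊓ (P ⊔ E) := le_inf le_sup_right (hsup.symm ▸ hY)
    _ = P ⊔ E ⊓ (P ⊔ Y) := by rw [inf_comm, sup_inf_assoc_of_le E le_sup_left]
    _ ≤ P := sup_le le_rfl (inf_comm E _ ▸ key.trans hSP)

end ModularLattice

namespace Fundament

/-! ### The modular lattice of closed normal subgroups, and compactness. -/

section Lattice

variable {H : Type u} [Group H] [TopologicalSpace H]

variable (H) in
/-- The closed normal subgroups of a topological group. -/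
abbrev ClosedNormal : Type u := {N : Subgroup H // N.Normal ∧ IsClosed (N : Set H)}

instance ClosedNormal.orderTop : OrderTop (ClosedNormal H) where
  top := ⟨⊤, inferInstance, isClosed_univ⟩
  le_top N := (le_top : N.1 ≤ ⊤)

theorem isMaximalNormalIn_iff_covBy (M N : ClosedNormal H) :
    IsMaximalNormalIn M.1 N.1 ↔ N ⋖ M := by
  constructor
  · intro h
    refine ⟨h.prop.2.2, fun K hNK hKM => hNK.not_ge ?_⟩
    exact h.le_of_ge ⟨K.2.1, K.2.2, hKM⟩ hNK.le
  · refine fun h => ⟨⟨N.2.1, N.2.2, h.lt⟩, fun K hK hNK => ?_⟩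
    rcases h.eq_or_eq (c := ⟨K, hK.1, hK.2.1⟩) hNK hK.2.2.le with e | e
    · exact (congrArg Subtype.val e).le
    · exact absurd (congrArg Subtype.val e) hK.2.2.ne

/-- The intersection of `M` with its lower covers, as a closed normal subgroup. -/
def ClosedNormal.coverInf (M : ClosedNormal H) : ClosedNormal H :=
  ⟨maximalNormalInf M.1, normal_maximalNormalInf _ M.2.1, isClosed_maximalNormalInf _ M.2.2⟩

theorem ClosedNormal.coverInf_le (M : ClosedNormal H) : M.coverInf ≤ M :=
  (inf_le_left : maximalNormalInf M.1 ≤ M.1)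

theorem ClosedNormal.coverInf_le_of_covBy {M N : ClosedNormal H} (h : N ⋖ M) : M.coverInf ≤ N :=
  (inf_le_right.trans (sInf_le ((isMaximalNormalIn_iff_covBy M N).2 h)) :
    maximalNormalInf M.1 ≤ N.1)

/-- `hY` matters when `M` has no lower cover: the intersection is then `M` itself. -/
theorem ClosedNormal.le_coverInf {M Y : ClosedNormal H} (hY : Y ≤ M) (h : ∀ N, N ⋖ M → Y ≤ N) :
    Y ≤ M.coverInf := by
  refine (le_inf hY (le_sInf fun N hN => ?_) : Y.1 ≤ M.1 ⊓ sInf {N | IsMaximalNormalIn M.1 N})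
  have hN' : IsMaximalNormalIn M.1 N := hN
  exact h ⟨N, hN'.prop.1, hN'.prop.2.1⟩ ((isMaximalNormalIn_iff_covBy M ⟨N, _⟩).1 hN')

variable [IsTopologicalGroup H] [CompactSpace H] [T2Space H]

instance ClosedNormal.lattice : Lattice (ClosedNormal H) :=
  Subtype.lattice
    (fun x y hx hy => by
      have := hx.1
      have := hy.1
      refine ⟨inferInstance, ?_⟩
      rw [Subgroup.normal_mul]
      exact (hx.2.isCompact.mul hy.2.isCompact).isClosed)
    (fun x y hx hy => by
      have := hx.1
      have := hy.1
      exact ⟨inferInstance, hx.2.inter hy.2⟩)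

theorem ClosedNormal.coe_sup (M N : ClosedNormal H) : (M ⊔ N).1 = M.1 ⊔ N.1 := rfl

theorem ClosedNormal.coe_inf (M N : ClosedNormal H) : (M ⊓ N).1 = M.1 ⊓ N.1 := rfl

theorem ClosedNormal.mem_sup {M N : ClosedNormal H} {x : H} :
    x ∈ (M ⊔ N).1 ↔ ∃ y ∈ M.1, ∃ z ∈ N.1, y * z = x := by
  have := M.2.1
  rw [ClosedNormal.coe_sup, ← SetLike.mem_coe, Subgroup.normal_mul, Set.mem_mul]
  rfl

/-- Joins are products of subgroups, so this is Dedekind's law. -/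
instance ClosedNormal.isModularLattice : IsModularLattice (ClosedNormal H) where
  sup_inf_le_assoc_of_le {x} y z hxz := by
    intro a ha
    obtain ⟨ha, haz⟩ := Subgroup.mem_inf.1 ha
    obtain ⟨b, hb, c, hc, rfl⟩ := ClosedNormal.mem_sup.1 ha
    exact ClosedNormal.mem_sup.2 ⟨b, hb, c, ⟨hc, (Subgroup.mul_mem_cancel_left _ (hxz hb)).1 haz⟩, rfl⟩

theorem ClosedNormal.mem_finset_inf {S : Finset (ClosedNormal H)} {x : H} :
    x ∈ (S.inf id).1 ↔ ∀ N ∈ S, x ∈ N.1 := by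
  classical
  induction S using Finset.induction_on with
  | empty => exact iff_of_true (Subgroup.mem_top x) (by simp)
  | insert N S _ ih =>
    rw [Finset.inf_insert, ClosedNormal.coe_inf, Subgroup.mem_inf, ih, Finset.forall_mem_insert]
    rfl

/-- An element lying in the product of `P` with every finite intersection of lower covers of `M`
lies in the product of `P` with the intersection of all of them. -/
theorem ClosedNormal.exists_finset_notMem {M P : ClosedNormal H} (hP : M.coverInf ≤ P) {x : H}
    (hx : x ∉ P.1) :
    ∃ S : Finset (ClosedNormal H), (∀ N ∈ S, N ⋖ M) ∧ x ∉ (P ⊔ (M ⊓ S.inf id)).1 := by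
  classical
  -- The set of `z ∈ M` with `x ∈ P z`. A point of it in every lower cover would lie in `M.coverInf
  -- ≤ P` and force `x ∈ P`; by compactness finitely many covers already exclude this.
  have hC : IsClosed ({z : H | x * z⁻¹ ∈ P.1} ∩ M.1) :=
    (P.2.2.preimage (continuous_const.mul continuous_inv)).inter M.2.2
  obtain ⟨u, hu⟩ := hC.isCompact.elim_finite_subfamily_closed
    (fun N : {N : ClosedNormal H // N ⋖ M} => (N.1.1 : Set H)) (fun N => N.1.2.2) (by
      refine Set.eq_empty_of_forall_notMem fun z hz => hx ?_
      obtain ⟨⟨hz1, hz2⟩, hz3⟩ := hz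
      have hzM : z ∈ M.coverInf.1 := by
        refine Subgroup.mem_inf.2 ⟨hz2, Subgroup.mem_sInf.2 fun N hN => ?_⟩
        have hN' : IsMaximalNormalIn M.1 N := hN
        exact Set.mem_iInter.1 hz3 ⟨⟨N, hN'.prop.1, hN'.prop.2.1⟩,
          (isMaximalNormalIn_iff_covBy M ⟨N, _⟩).1 hN'⟩
      simpa using P.1.mul_mem hz1 (hP hzM))
  refine ⟨u.image Subtype.val, fun N hN => ?_, fun h => ?_⟩
  · obtain ⟨N, -, rfl⟩ := Finset.mem_image.1 hN
    exact N.2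
  · obtain ⟨y, hy, z, hz, rfl⟩ := ClosedNormal.mem_sup.1 h
    obtain ⟨hzM, hzS⟩ := Subgroup.mem_inf.1 hz
    refine Set.eq_empty_iff_forall_notMem.1 hu z ⟨⟨by simpa using hy, hzM⟩, ?_⟩
    exact Set.mem_iInter₂.2 fun N hN =>
      ClosedNormal.mem_finset_inf.1 hzS N.1 (Finset.mem_image_of_mem _ hN)

/-- Every closed normal subgroup between `M` and the intersection of its lower covers is itself
the intersection of the lower covers of `M` that contain it. -/
theorem ClosedNormal.le_of_forall_covBy_le {M P Y : ClosedNormal H} (hPM : P ≤ M)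
    (hP : M.coverInf ≤ P) (hY : Y ≤ M) (h : ∀ T, P ≤ T → T ⋖ M → Y ≤ T) : Y ≤ P := by
  intro x hxY
  by_contra hx
  obtain ⟨S, hS, hxS⟩ := ClosedNormal.exists_finset_notMem hP hx
  -- `P` is enlarged to contain a finite meet of lower covers while still avoiding `x`.
  exact hxS (_root_.le_of_forall_covBy_le (sup_le hPM inf_le_left) S hS le_sup_right hY
    (fun T hT => h T (le_sup_left.trans hT)) hxY)

end Lattice

/-! ### Behaviour under epimorphisms. -/

section Hom

variable {H H' : Type u} [Group H] [TopologicalSpace H] [IsTopologicalGroup H] [CompactSpace H]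
  [T2Space H] [Group H'] [TopologicalSpace H'] [IsTopologicalGroup H'] [CompactSpace H']
  [T2Space H']

/-- The preimage of a closed normal subgroup under a continuous homomorphism. -/
def ClosedNormal.comap (f : H →ₜ* H') (N : ClosedNormal H') : ClosedNormal H :=
  ⟨N.1.comap f.toMonoidHom, N.2.1.comap _, N.2.2.preimage f.continuous_toFun⟩

/-- The image of a closed normal subgroup under an epimorphism of compact groups. -/
def ClosedNormal.map (f : H →ₜ* H') (hf : Function.Surjective f) (N : ClosedNormal H) :
    ClosedNormal H' :=
  ⟨N.1.map f.toMonoidHom, N.2.1.map _ hf, (N.2.2.isCompact.image f.continuous_toFun).isClosed⟩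

/-- The kernel of a continuous homomorphism. -/
def ClosedNormal.ker (f : H →ₜ* H') : ClosedNormal H :=
  ⟨f.toMonoidHom.ker, inferInstance, isClosed_singleton.preimage f.continuous_toFun⟩

set_option linter.unusedSectionVars false

theorem ClosedNormal.comap_le_comap (f : H →ₜ* H') (hf : Function.Surjective f)
    {A B : ClosedNormal H'} :
    A.comap f ≤ B.comap f ↔ A ≤ B := Subgroup.comap_le_comap_of_surjective hf

theorem ClosedNormal.comap_map (f : H →ₜ* H') (hf : Function.Surjective f)
    (A : ClosedNormal H) :
    (A.map f hf).comap f = A ⊔ ClosedNormal.ker f :=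
  Subtype.ext (Subgroup.comap_map_eq f.toMonoidHom A.1)

theorem ClosedNormal.map_le_iff (f : H →ₜ* H') (hf : Function.Surjective f)
    {A : ClosedNormal H} {B : ClosedNormal H'} :
    A.map f hf ≤ B ↔ A ≤ B.comap f := Subgroup.map_le_iff_le_comap

/-- Anything above a preimage contains the kernel, hence is itself a preimage. -/
theorem ClosedNormal.comap_covBy_comap (f : H →ₜ* H') (hf : Function.Surjective f)
    {A B : ClosedNormal H'} :
    A.comap f ⋖ B.comap f ↔ A ⋖ B := by
  have hlt {A B : ClosedNormal H'} : A.comap f < B.comap f ↔ A < B := by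
    simp only [lt_iff_le_not_ge, ClosedNormal.comap_le_comap f hf]
  refine and_congr hlt ⟨fun h C hAC hCB => h (hlt.2 hAC) (hlt.2 hCB), fun h C hAC hCB => ?_⟩
  have hC : (C.map f hf).comap f = C := by
    rw [ClosedNormal.comap_map, sup_eq_left]
    refine le_trans (fun x hx => ?_) hAC.le
    exact Subgroup.ker_le_comap f.toMonoidHom A.1 hx
  rw [← hC] at hAC hCB
  exact h (hlt.1 hAC) (hlt.1 hCB)

theorem ClosedNormal.coverInf_le_comap (f : H →ₜ* H') (hf : Function.Surjective f)
    {M : ClosedNormal H} {M' : ClosedNormal H'}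
    (h : M ≤ M'.comap f) : M.coverInf ≤ M'.coverInf.comap f := by
  rw [← ClosedNormal.map_le_iff f hf]
  refine ClosedNormal.le_coverInf ?_ fun N hN => ?_
  · exact (ClosedNormal.map_le_iff f hf).2 (M.coverInf_le.trans h)
  · rw [ClosedNormal.map_le_iff]
    by_cases hMN : M ≤ N.comap f
    · exact M.coverInf_le.trans hMN
    · exact (ClosedNormal.coverInf_le_of_covBy
        (((ClosedNormal.comap_covBy_comap f hf).2 hN).inf_covBy_left_of_not_le h hMN)).trans
        inf_le_right

/-- The hard inclusion: lower covers of `M` containing `M ⊓ ker f` map to lower covers of the image,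
and by semisimplicity they cut out `M.coverInf ⊔ (M ⊓ ker f)`, whose second factor dies under `f`.
-/
theorem ClosedNormal.map_coverInf (f : H →ₜ* H') (hf : Function.Surjective f)
    (M : ClosedNormal H) :
    M.coverInf.map f hf = (M.map f hf).coverInf := by
  have hle : M ≤ (M.map f hf).comap f := by rw [ClosedNormal.comap_map]; exact le_sup_left
  refine le_antisymm ((ClosedNormal.map_le_iff f hf).2
    (ClosedNormal.coverInf_le_comap f hf hle)) ?_
  have key : M ⊓ (M.map f hf).coverInf.comap f ≤ M.coverInf ⊔ (M ⊓ ClosedNormal.ker f) := by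
    refine ClosedNormal.le_of_forall_covBy_le (sup_le M.coverInf_le inf_le_left) le_sup_left
      inf_le_left fun T hT hTM => ?_
    -- Modular law, using that `T` contains `M ⊓ ker f`: passing to the image and back loses nothing
    -- inside `M`.
    have hTK : M ⊓ (T ⊔ ClosedNormal.ker f) = T := by
      rw [inf_comm, sup_inf_assoc_of_le _ hTM.le, sup_eq_left, inf_comm]
      exact le_sup_right.trans hT
    have hcov : T.map f hf ⋖ M.map f hf := by
      rw [← ClosedNormal.comap_covBy_comap f hf, ClosedNormal.comap_map, ClosedNormal.comap_map]
      have := covBy_sup_of_inf_covBy_left (hTK.symm ▸ hTM :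
        M ⊓ (T ⊔ ClosedNormal.ker f) ⋖ M)
      rwa [← sup_assoc, sup_eq_left.2 hTM.le] at this
    calc M ⊓ (M.map f hf).coverInf.comap f ≤ M ⊓ (T.map f hf).comap f :=
          inf_le_inf_left _ ((ClosedNormal.comap_le_comap f hf).2
            (ClosedNormal.coverInf_le_of_covBy hcov))
      _ = T := by rw [ClosedNormal.comap_map, hTK]
  intro y hy
  obtain ⟨x, hxM, rfl⟩ := (M.map f hf).coverInf_le hy
  obtain ⟨a, ha, b, hb, rfl⟩ := ClosedNormal.mem_sup.1 (key ⟨hxM, hy⟩)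
  refine ⟨a, ha, ?_⟩
  rw [map_mul, show f.toMonoidHom b = 1 from hb.2, mul_one]

end Hom

/-! ### The fundament series and its kernels. -/

section Series

variable {H G : ProfiniteGrp.{u}} (π : H ⟶ G)

/-- The fundament kernel series as a series of closed normal subgroups. -/
def closedKernelSeries (k : ℕ) : ClosedNormal H :=
  ⟨kernelSeries π k, inferInstance, isClosed_kernelSeries π k⟩

theorem ker_proj (k : ℕ) : (proj π k).hom.toMonoidHom.ker = kernelSeries π k := by
  cases k with
  | zero => rfl
  | succ k => exact QuotientGroup.ker_mk' _

theorem proj_surjective (hπ : Function.Surjective π) (k : ℕ) :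
    Function.Surjective (proj π k) := by
  cases k with
  | zero => exact hπ
  | succ k => exact QuotientGroup.mk'_surjective _

theorem proj_succ_comp_series (k : ℕ) : proj π (k + 1) ≫ series π k = proj π k := by
  cases k with
  | zero => rfl
  | succ k => rfl

theorem series_proj_succ (k : ℕ) (x : H) : series π k (proj π (k + 1) x) = proj π k x := by
  rw [← proj_succ_comp_series π k]
  rfl

theorem series_surjective (hπ : Function.Surjective π) (k : ℕ) :
    Function.Surjective (series π k) := by
  intro y
  obtain ⟨x, rfl⟩ := proj_surjective π hπ k y
  exact ⟨proj π (k + 1) x, series_proj_succ π k x⟩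

theorem mem_kernelSeries_iff (k : ℕ) (x : H) : x ∈ kernelSeries π k ↔ proj π k x = 1 := by
  rw [← ker_proj]
  exact MonoidHom.mem_ker

/-- The kernel of each fundament is the image of the corresponding kernel in `H`. -/
theorem ker_series (k : ℕ) :
    (series π k).hom.toMonoidHom.ker =
      (kernelSeries π k).map (proj π (k + 1)).hom.toMonoidHom := by
  ext y
  constructor
  · intro hy
    obtain ⟨x, rfl⟩ := QuotientGroup.mk'_surjective (kernelSeries π (k + 1)) y
    refine ⟨x, (mem_kernelSeries_iff π k x).2 ?_, rfl⟩
    rw [← series_proj_succ]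
    exact hy
  · rintro ⟨x, hx, rfl⟩
    exact (series_proj_succ π k x).trans ((mem_kernelSeries_iff π k x).1 hx)

end Series

/-! ### Induced maps, semi-cartesian squares and isomorphisms. -/

section Squares

variable {H G H' G' : ProfiniteGrp.{u}} {π : H ⟶ G} {θ₀ : G ⟶ G'} {θ : H ⟶ H'} {π' : H' ⟶ G'}

theorem kernelSeries_le_comap (h : IsEpiSquare π θ₀ θ π') (k : ℕ) :
    kernelSeries π k ≤ (kernelSeries π' k).comap θ.hom.toMonoidHom := by
  induction k with
  | zero =>
    intro x hx
    have hw : π' (θ x) = θ₀ (π x) := ConcreteCategory.congr_hom h.w x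
    have hx' : π x = 1 := hx
    change π' (θ x) = 1
    rw [hw, hx', map_one]
  | succ k ih =>
    exact ClosedNormal.coverInf_le_comap θ.hom h.surjective_top (M := closedKernelSeries π k)
      (M' := closedKernelSeries π' k) ih

theorem map_kernelSeries (h : IsSemiCartesian π θ₀ θ π') (k : ℕ) :
    (kernelSeries π k).map θ.hom.toMonoidHom = kernelSeries π' k := by
  induction k with
  | zero => exact h.map_ker
  | succ k ih =>
    have hM : (closedKernelSeries π k).map θ.hom h.surjective_top = closedKernelSeries π' k :=
      Subtype.ext ih
    have := ClosedNormal.map_coverInf θ.hom h.surjective_top (closedKernelSeries π k)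
    rw [hM] at this
    exact congrArg Subtype.val this

/-- The maps induced by a commutative square of epimorphisms between the terms of the fundament
series. -/
def termMap (h : IsEpiSquare π θ₀ θ π') : (k : ℕ) → (term π k ⟶ term π' k)
  | 0 => θ₀
  | k + 1 => ProfiniteGrp.ofHom (X := H ⧸ kernelSeries π (k + 1))
      (Y := H' ⧸ kernelSeries π' (k + 1))
      ⟨QuotientGroup.map _ _ θ.hom.toMonoidHom (kernelSeries_le_comap h (k + 1)),
        continuous_quot_lift _ (QuotientGroup.continuous_mk.comp θ.hom.continuous_toFun)⟩

theorem comp_proj_eq_proj_comp_termMap (h : IsEpiSquare π θ₀ θ π') (k : ℕ) :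
    θ ≫ proj π' k = proj π k ≫ termMap h k := by
  cases k with
  | zero => exact h.w
  | succ k => rfl

theorem IsEpiSquare.proj_square (h : IsEpiSquare π θ₀ θ π') {k : ℕ} {t : term π k ⟶ term π' k}
    (ht : θ ≫ proj π' k = proj π k ≫ t) : IsEpiSquare (proj π k) t θ (proj π' k) where
  w := ht
  surjective_left := proj_surjective π h.surjective_left k
  surjective_top := h.surjective_top
  surjective_right := proj_surjective π' h.surjective_right k
  surjective_bottom y := by
    obtain ⟨x', rfl⟩ := proj_surjective π' h.surjective_right k y
    obtain ⟨x, rfl⟩ := h.surjective_top x'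
    exact ⟨proj π k x, (ConcreteCategory.congr_hom ht x).symm⟩

theorem isSeriesDiagram_termMap (h : IsEpiSquare π θ₀ θ π') :
    IsSeriesDiagram π θ₀ θ π' (termMap h) where
  zero := rfl
  top_triangle := proj_succ_comp_series π
  bottom_triangle := proj_succ_comp_series π'
  proj_square k := h.proj_square (comp_proj_eq_proj_comp_termMap h k)
  series_square k :=
    { w := by
        ext y
        obtain ⟨x, rfl⟩ := proj_surjective π h.surjective_left (k + 1) y
        have h1 (k : ℕ) : proj π' k (θ x) = termMap h k (proj π k x) :=
          ConcreteCategory.congr_hom (comp_proj_eq_proj_comp_termMap h k) x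
        change series π' k (termMap h (k + 1) (proj π (k + 1) x)) =
          termMap h k (series π k (proj π (k + 1) x))
        rw [← h1, series_proj_succ, series_proj_succ, h1]
      surjective_left := series_surjective π h.surjective_left k
      surjective_right := series_surjective π' h.surjective_right k
      surjective_bottom := (h.proj_square (comp_proj_eq_proj_comp_termMap h k)).surjective_bottom
      surjective_top :=
        (h.proj_square (comp_proj_eq_proj_comp_termMap h (k + 1))).surjective_bottom }

variable {t : (k : ℕ) → (term π k ⟶ term π' k)}

theorem IsSeriesDiagram.proj_semiCartesian (ht : IsSeriesDiagram π θ₀ θ π' t)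
    (h : IsSemiCartesian π θ₀ θ π') (k : ℕ) :
    IsSemiCartesian (proj π k) (t k) θ (proj π' k) where
  toIsEpiSquare := ht.proj_square k
  map_ker := by rw [ker_proj, ker_proj, map_kernelSeries h]

theorem IsSeriesDiagram.series_semiCartesian (ht : IsSeriesDiagram π θ₀ θ π' t)
    (h : IsSemiCartesian π θ₀ θ π') (k : ℕ) :
    IsSemiCartesian (series π k) (t k) (t (k + 1)) (series π' k) where
  toIsEpiSquare := ht.series_square k
  map_ker := by
    have hc : (t (k + 1)).hom.toMonoidHom.comp (proj π (k + 1)).hom.toMonoidHom =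
        (proj π' (k + 1)).hom.toMonoidHom.comp θ.hom.toMonoidHom :=
      MonoidHom.ext fun x => (ConcreteCategory.congr_hom (ht.proj_square (k + 1)).w x).symm
    rw [ker_series, ker_series, Subgroup.map_map, hc, ← Subgroup.map_map, map_kernelSeries h]

theorem isIso_of_bijective {A B : ProfiniteGrp.{u}} (f : A ⟶ B) (hf : Function.Bijective f) :
    IsIso f := by
  have : IsIso ((forget ProfiniteGrp).map f) := (isIso_iff_bijective _).2 hf
  -- A continuous bijection between compact Hausdorff spaces is a homeomorphism.
  exact isIso_of_reflects_iso f (forget ProfiniteGrp)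

theorem bijective_of_isIso {A B : ProfiniteGrp.{u}} (f : A ⟶ B) [IsIso f] :
    Function.Bijective f :=
  (isIso_iff_bijective ((forget ProfiniteGrp).map f)).1 inferInstance

/-- Injectivity of `θ₀` makes `π' ∘ θ` and `π` have the same kernel, and `θ` is onto. -/
theorem IsEpiSquare.isSemiCartesian_of_injective (h : IsEpiSquare π θ₀ θ π')
    (h0 : Function.Injective θ₀) : IsSemiCartesian π θ₀ θ π' where
  toIsEpiSquare := h
  map_ker := by
    have hw (x : H) : π' (θ x) = θ₀ (π x) := ConcreteCategory.congr_hom h.w x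
    refine le_antisymm (Subgroup.map_le_iff_le_comap.2 (kernelSeries_le_comap h 0)) fun y hy => ?_
    obtain ⟨x, rfl⟩ := h.surjective_top y
    have hy' : π' (θ x) = 1 := hy
    exact ⟨x, h0 ((hw x).symm.trans (hy'.trans (map_one θ₀.hom).symm)), rfl⟩

/-- If `t k` kills the class of `x`, then `θ x` lies in the `k`-th kernel of `π'`, the image of that
of `π`; injectivity of `θ` puts `x` in the latter. -/
theorem IsSeriesDiagram.isIso (ht : IsSeriesDiagram π θ₀ θ π' t) (h : IsSemiCartesian π θ₀ θ π')
    (hθ : Function.Injective θ) (k : ℕ) : IsIso (t k) := by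
  refine isIso_of_bijective _ ⟨?_, (ht.proj_square k).surjective_bottom⟩
  rw [injective_iff_map_eq_one]
  intro y hy
  obtain ⟨x, rfl⟩ := (ht.proj_square k).surjective_left y
  have hw : proj π' k (θ x) = t k (proj π k x) :=
    ConcreteCategory.congr_hom (ht.proj_square k).w x
  have hx : θ x ∈ kernelSeries π' k := (mem_kernelSeries_iff π' k _).2 (hw.trans hy)
  rw [← map_kernelSeries h] at hx
  obtain ⟨z, hz, hzx⟩ := hx
  rw [← mem_kernelSeries_iff, ← hθ hzx]
  exact hz

end Squares

end Fundament

theorem mainTheorem11 {H G H' G' : ProfiniteGrp.{u}}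
    (π : H ⟶ G) (θ₀ : G ⟶ G') (θ : H ⟶ H') (π' : H' ⟶ G')
    (hsq : Fundament.IsEpiSquare π θ₀ θ π') :
    (∃ t : (k : ℕ) → (Fundament.term π k ⟶ Fundament.term π' k),
      Fundament.IsSeriesDiagram π θ₀ θ π' t) ∧
    (∀ t : (k : ℕ) → (Fundament.term π k ⟶ Fundament.term π' k),
      Fundament.IsSeriesDiagram π θ₀ θ π' t →
      (Fundament.IsSemiCartesian π θ₀ θ π' →
        ∀ k, Fundament.IsSemiCartesian (Fundament.proj π k) (t k) θ (Fundament.proj π' k) ∧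
          Fundament.IsSemiCartesian (Fundament.series π k) (t k) (t (k + 1))
            (Fundament.series π' k)) ∧
      (IsIso θ₀ → IsIso θ → ∀ k, IsIso (t k))) := by
  refine ⟨⟨_, Fundament.isSeriesDiagram_termMap hsq⟩, fun t ht =>
    ⟨fun h k => ⟨ht.proj_semiCartesian h k, ht.series_semiCartesian h k⟩, fun h0 h1 k => ?_⟩⟩
  exact ht.isIso (hsq.isSemiCartesian_of_injective (Fundament.bijective_of_isIso θ₀).1)
    (Fundament.bijective_of_isIso θ).1 k
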